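/- Let $p$ be an odd prime, let $A$ be a finite elementary abelian $p$-group, and let $e$ be a primitive idempotent of $\mathbb{Q}_p[A]$ different from the trivial one $\frac{1}{|A|}\sum_{\gamma\in A}\gamma$. Let $e\mathbb{Z}_p[A]=\{ex : x\in\mathbb{Z}_p[A]\}\subset\mathbb{Q}_p[A]$, a commutative ring with identity $e$ that is a quotient of $\mathbb{Z}_p[A]$ via $x\mapsto ex$, and let $$I_e:=\bigcap_{1\neq\gamma\in A}\Bigl(1-\gamma,\ \sum_{j=1}^{\mathrm{ord}(\gamma)}\gamma^j\Bigr)e\mathbb{Z}_p[A].$$ For a finite abelian group $D$, a subgroup $I'\le D$ with $D/I'$ cyclic, and a finite $D$-module $M$, let $\widehat D:=\hat{\mathbb{Z}}\times_{D/I'}D$ be the fibre product of the projection $D\to D/I'$ with a continuous surjection $\hat{\mathbb{Z}}\to D/I'$, and let $R(D,I',M)$ be the kernel of the inflation map $H^2(D,M)\to H^2(\widehat D,M)$ (continuous cohomology; $R(D,I',M)$ does not depend on the chosen surjection). For a finite $A$-module $M$ put $$N_{\mathrm{typical}}(A,M):=\ker\Bigl(H^2(A,M)\to\bigoplus_{(D,I')\in\mathcal{C}}\frac{H^2(D,M)}{R(D,I',M)}\Bigr),$$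 where $\mathcal{C}$ is the set of pairs $(D,I')$ with $D$ a subgroup of $A$ generated by at most two elements and $I'$ a cyclic subgroup of $D$ with $D/I'$ cyclic, and the maps are induced by restriction. Then for every proper ideal $I$ of $e\mathbb{Z}_p[A]$ containing $I_e$ one has $$N_{\mathrm{typical}}\bigl(A,\ e\mathbb{Z}_p[A]/I\bigr)=0.$$ -/

import Mathlib

/-! ## The profinite group `ℤ̂` and the fibre products `D̂ = ℤ̂ ×_{D/I} D` -/

/-- The (multiplicatively written) profinite completion `ℤ̂` of the integers. -/
abbrev ZHat : Type :=
  ProfiniteGrp.ProfiniteCompletion.completion (GrpCat.of (Multiplicative ℤ))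

/-- The continuous extension `ℤ̂ → Q` of a homomorphism `f` from `ℤ` to a finite discrete
group `Q`: project `ℤ̂` to the finite quotient `ℤ / ker f`, which embeds into `Q`. -/
def ZHat.lift {Q : Type*} [Group Q] [Finite Q] [TopologicalSpace Q] [DiscreteTopology Q]
    (f : Multiplicative ℤ →* Q) : ZHat →ₜ* Q where
  toFun z := QuotientGroup.kerLift f (z.1 { toSubgroup := f.ker })
  map_one' := map_one (QuotientGroup.kerLift f)
  map_mul' x y := map_mul (QuotientGroup.kerLift f)
    (x.1 { toSubgroup := f.ker }) (y.1 { toSubgroup := f.ker })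
  continuous_toFun := by
    refine Continuous.comp
      (Y := (ProfiniteGrp.ProfiniteCompletion.diagram (GrpCat.of (Multiplicative ℤ))).obj
        { toSubgroup := f.ker }) (g := QuotientGroup.kerLift f) ?_
      ((continuous_apply _).comp continuous_subtype_val)
    have : DiscreteTopology
      ((ProfiniteGrp.ProfiniteCompletion.diagram (GrpCat.of (Multiplicative ℤ))).obj
        { toSubgroup := f.ker }) := ⟨rfl⟩
    exact continuous_of_discreteTopology

/-- A quotient map `ℤ̂ → Q` onto a finite cyclic group `Q`, sending `1 ∈ ℤ` to a chosen
generator of `Q`. -/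
noncomputable def ZHat.toCyclic (Q : Type*) [Group Q] [Finite Q] [TopologicalSpace Q]
    [DiscreteTopology Q] [IsCyclic Q] : ZHat →ₜ* Q :=
  ZHat.lift (zpowersHom Q (IsCyclic.exists_generator (α := Q)).choose)

theorem ZHat.toCyclic_surjective (Q : Type*) [Group Q] [Finite Q] [TopologicalSpace Q]
    [DiscreteTopology Q] [IsCyclic Q] : Function.Surjective (ZHat.toCyclic Q) := by
  intro x
  obtain ⟨n, hn⟩ := (IsCyclic.exists_generator (α := Q)).choose_spec x
  refine ⟨ProfiniteGrp.ProfiniteCompletion.etaFn (GrpCat.of (Multiplicative ℤ))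
    (Multiplicative.ofAdd n), ?_⟩
  rw [← hn]
  rfl

section DHat

variable {D : Type*} [CommGroup D] [Finite D] [TopologicalSpace D] [DiscreteTopology D]

/-- The fibre product `D̂ = ℤ̂ ×_{D/I} D`, a profinite group. -/
noncomputable def DHat (I : Subgroup D) [IsCyclic (D ⧸ I)] : Subgroup (ZHat × D) where
  carrier := {x | ZHat.toCyclic (D ⧸ I) x.1 = (x.2 : D ⧸ I)}
  one_mem' := map_one (ZHat.toCyclic (D ⧸ I))
  mul_mem' {x y} hx hy := by
    simp only [Set.mem_ofPred_eq, Prod.fst_mul, Prod.snd_mul, QuotientGroup.mk_mul] at *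
    exact (map_mul (ZHat.toCyclic (D ⧸ I)) x.1 y.1).trans (by rw [hx, hy])
  inv_mem' {x} hx := by
    simp only [Set.mem_ofPred_eq, Prod.fst_inv, Prod.snd_inv, QuotientGroup.mk_inv] at *
    exact (map_inv (ZHat.toCyclic (D ⧸ I)) x.1).trans (by rw [hx])

/-- The projection `D̂ → D`. -/
noncomputable def DHat.proj (I : Subgroup D) [IsCyclic (D ⧸ I)] : DHat I →ₜ* D where
  toMonoidHom := (MonoidHom.snd ZHat D).comp (DHat I).subtype
  continuous_toFun := continuous_snd.comp continuous_subtype_val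

end DHat

/-! ## Cohomology -/

/-- A discrete `G`-module, as a topological representation of `G` over the discrete ring `ℤ`. -/
def discreteRep (G M : Type*) [Group G] [AddCommGroup M] [TopologicalSpace M]
    [DiscreteTopology M] [DistribMulAction G M] : TopRep ℤ G :=
  TopRep.of (ContRepresentation.ofMonoidHom (R := ℤ)
    { toFun := fun g =>
        ⟨(DistribSMul.toAddMonoidHom M g).toIntLinearMap, continuous_of_discreteTopology⟩
      map_one' := by ext m; exact one_smul G m
      map_mul' := fun g h => by ext m; exact mul_smul g h m })

section Cohomology

universe u

/-- The map `H²(G, X) → H²(H, X)` on continuous cohomology induced by a continuous homomorphism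
`φ : H → G`: restriction if `φ` is the inclusion of a subgroup, inflation if `φ` is a quotient
map. -/
noncomputable def pullbackH2 {G H : Type u} [Group G] [TopologicalSpace G] [IsTopologicalGroup G]
    [Group H] [TopologicalSpace H] [IsTopologicalGroup H] (φ : H →ₜ* G) (X : TopRep.{u} ℤ G) :
    continuousCohomology 2 X →+ continuousCohomology 2 (TopRep.res (φ : H →* G) X) :=
  (ContinuousCohomology.map φ (CategoryTheory.CategoryStruct.id (TopRep.res (φ : H →* G) X))
    2).hom.toLinearMap.toAddMonoidHom

/-- `R(D, I, X)`: the kernel of the inflation map `H²(D, X) → H²(D̂, X)`. -/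
noncomputable def kerInflation {D : Type u} [CommGroup D] [Finite D] [TopologicalSpace D]
    [DiscreteTopology D] (I : Subgroup D) [IsCyclic (D ⧸ I)] (X : TopRep.{u} ℤ D) :
    AddSubgroup (continuousCohomology 2 X) :=
  (pullbackH2 (DHat.proj I) X).ker

/-- The set `𝒞` of pairs `(D, I)`, where `D` is a subgroup of `A` generated by (at most) two
elements and `I` is a cyclic subgroup of `D` with `D / I` cyclic. -/
structure CPair (A : Type*) [CommGroup A] where
  D : Subgroup A
  I : Subgroup D
  two_generated : ∃ x y : A, D = Subgroup.closure {x, y}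
  cyclic : IsCyclic I
  cyclic_quotient : IsCyclic (D ⧸ I)

attribute [instance] CPair.cyclic_quotient

/-- The inclusion of a subgroup, as a continuous homomorphism. -/
def inclusionHom {A : Type*} [Group A] [TopologicalSpace A] (D : Subgroup A) : D →ₜ* A where
  toMonoidHom := D.subtype
  continuous_toFun := continuous_subtype_val

/-- `N_typical(A, M) = ker (H²(A, M) → ⨁_{(D, I) ∈ 𝒞} H²(D, M) / R(D, I, M))`
(the sum is finite, hence written as a product). -/
noncomputable def NTypical (A M : Type u) [CommGroup A] [Finite A] [TopologicalSpace A]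
    [DiscreteTopology A] [AddCommGroup M] [TopologicalSpace M] [DiscreteTopology M]
    [DistribMulAction A M] : AddSubgroup (continuousCohomology 2 (discreteRep A M)) :=
  (AddMonoidHom.pi fun c : CPair A =>
    (QuotientAddGroup.mk'
      (kerInflation c.I (TopRep.res (inclusionHom c.D : c.D →* A) (discreteRep A M)))).comp
      (pullbackH2 (inclusionHom c.D) (discreteRep A M))).ker

end Cohomology

/-! ## The rings `eℤ_p[A]` and the modules `eℤ_p[A]/I` -/

/-- A primitive idempotent of a commutative ring: a nonzero idempotent that is not the sum of two
nonzero orthogonal idempotents. -/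
structure IsPrimitiveIdempotent {R : Type*} [CommRing R] (e : R) : Prop where
  idem : IsIdempotentElem e
  ne_zero : e ≠ 0
  primitive : ∀ f g : R, IsIdempotentElem f → IsIdempotentElem g → f * g = 0 → e = f + g →
    f = 0 ∨ g = 0

section Idempotents

variable {p : ℕ} [Fact p.Prime] {A : Type*} [CommGroup A]

/-- The trivial primitive idempotent `|A|⁻¹ ∑_{γ ∈ A} γ` of `ℚ_p[A]`. -/
noncomputable def trivialIdempotent (p : ℕ) [Fact p.Prime] (A : Type*) [CommGroup A] [Fintype A] :
    MonoidAlgebra ℚ_[p] A :=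
  (Fintype.card A : ℚ_[p])⁻¹ • ∑ γ : A, MonoidAlgebra.of ℚ_[p] A γ

variable {e : MonoidAlgebra ℚ_[p] A} (he : IsIdempotentElem e)

/-- The ring homomorphism `x ↦ e x = e x e` from `ℤ_p[A]` to the ring `eℚ_p[A]`, whose identity is `e`. -/
noncomputable def mulIdem : MonoidAlgebra ℤ_[p] A →+* he.Corner where
  toFun x := ⟨e * MonoidAlgebra.mapRingHom A (algebraMap ℤ_[p] ℚ_[p]) x * e, _, rfl⟩
  map_one' := Subtype.ext (by
    change e * MonoidAlgebra.mapRingHom A _ 1 * e = e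
    rw [map_one, mul_one, he.eq])
  map_mul' x y := Subtype.ext (by
    change e * MonoidAlgebra.mapRingHom A _ (x * y) * e =
      (e * MonoidAlgebra.mapRingHom A _ x * e) * (e * MonoidAlgebra.mapRingHom A _ y * e)
    rw [map_mul]
    linear_combination (-(MonoidAlgebra.mapRingHom A (algebraMap ℤ_[p] ℚ_[p]) x *
      MonoidAlgebra.mapRingHom A (algebraMap ℤ_[p] ℚ_[p]) y) * (1 + e)) * he.eq * e)
  map_zero' := Subtype.ext (by
    change e * MonoidAlgebra.mapRingHom A _ 0 * e = 0
    rw [map_zero, mul_zero, zero_mul])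
  map_add' x y := Subtype.ext (by
    change e * MonoidAlgebra.mapRingHom A _ (x + y) * e =
      e * MonoidAlgebra.mapRingHom A _ x * e + e * MonoidAlgebra.mapRingHom A _ y * e
    rw [map_add]
    ring)

/-- The ring `eℤ_p[A] = {e x | x ∈ ℤ_p[A]} ⊆ eℚ_p[A]`. -/
noncomputable def EZp : Subring he.Corner := (mulIdem he).range

/-- The quotient map `ℤ_p[A] → eℤ_p[A]`, `x ↦ e x`. -/
noncomputable def EZp.proj : MonoidAlgebra ℤ_[p] A →+* EZp he := (mulIdem he).rangeRestrict

/-- The ideal `I_e = ⋂_{1 ≠ γ ∈ A} (1 - γ, ∑_{j=1}^{ord γ} γ^j) eℤ_p[A]` of `eℤ_p[A]`. -/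
noncomputable def idealIe : Ideal (EZp he) :=
  ⨅ γ : {γ : A // γ ≠ 1}, Ideal.span
    {EZp.proj he (1 - MonoidAlgebra.of ℤ_[p] A γ),
      EZp.proj he (∑ j ∈ Finset.Icc 1 (orderOf (γ : A)), MonoidAlgebra.of ℤ_[p] A γ ^ j)}

/-- The discrete `A`-module `eℤ_p[A] / I`; `γ ∈ A` acts as multiplication by `e γ`. -/
def EZpQuot (I : Ideal (EZp he)) : Type _ := EZp he ⧸ I

variable {he} (I : Ideal (EZp he))

noncomputable instance : AddCommGroup (EZpQuot he I) :=
  inferInstanceAs (AddCommGroup (EZp he ⧸ I))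

noncomputable instance : Module (EZp he) (EZpQuot he I) :=
  inferInstanceAs (Module (EZp he) (EZp he ⧸ I))

noncomputable instance : DistribMulAction A (EZpQuot he I) :=
  DistribMulAction.compHom (EZpQuot he I)
    (((EZp.proj he : _ →+* _) : MonoidAlgebra ℤ_[p] A →* EZp he).comp (MonoidAlgebra.of ℤ_[p] A))

instance : TopologicalSpace (EZpQuot he I) := ⊥

instance : DiscreteTopology (EZpQuot he I) := ⟨rfl⟩

end Idempotents

/-! A class in `NTypical` is represented by a 2-cocycle, hence by an extension E of A by M, and it
vanishes once E → A splits. For a, b in A, take D = ⟨a, b⟩ and I = ⟨b⟩. The class dies on D̂, so D̂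
→ A lifts to E. The elements (z, a) and (1, b) of D̂ commute and the second has p-th power 1, so a
and b have commuting lifts, the one of b killed by p (`exists_commuting_lifts`).

Primitivity of e makes the corner ring of e a domain, so A acts on M through a cyclic quotient: A =
⟨σ⟩B with B acting trivially (`exists_zpow_mul_smul_eq`). Lifts of elements of B centralize M, so
whether a lift of b in B commutes with a lift of a does not depend on the chosen lift of a. Hence a
lift s of σ with s^p = 1, together with suitable lifts of the elements of B, generates an abelian
group of exponent p mapping onto A. By linear algebra over F_p this surjection splits
(`exists_section_of_commuting_lifts`). -/

section

open CategoryTheory Limits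

/-! ### Homology of complexes of topological modules, elementwise -/

namespace TopModuleCat

variable {R : Type*} [Ring R] [TopologicalSpace R] {ι : Type*} {c : ComplexShape ι}
  (K : HomologicalComplex (TopModuleCat R) c)

/-- Homology is a cokernel of `toCycles`, so it is isomorphic to the concrete quotient module, whose
projection is onto. -/
theorem homologyπ_surjective (j : ι) : Function.Surjective (K.homologyπ j) := by
  let i := c.prev j
  let α := (K.homologyIsCokernel i j rfl).coconePointUniqueUpToIso
    (isColimitCoker (K.toCycles i j))
  have hα : K.homologyπ j ≫ α.hom = cokerπ (K.toCycles i j) :=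
    (K.homologyIsCokernel i j rfl).comp_coconePointUniqueUpToIso_hom _ WalkingParallelPair.one
  intro x
  obtain ⟨z, hz⟩ := cokerπ_surjective (K.toCycles i j) (α.hom x)
  refine ⟨z, ?_⟩
  have h := ConcreteCategory.congr_hom hα z
  have h2 : α.inv (α.hom (K.homologyπ j z)) = α.inv (α.hom x) := by
    rw [← hz]; exact congrArg α.inv h
  simpa using h2

theorem exists_toCycles_eq_of_homologyπ_eq_zero {i j : ι} (hij : c.prev j = i) {z : K.cycles j}
    (hz : K.homologyπ j z = 0) : ∃ y : K.X i, K.toCycles i j y = z := by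
  let α := (K.homologyIsCokernel i j hij).coconePointUniqueUpToIso
    (isColimitCoker (K.toCycles i j))
  have hα : K.homologyπ j ≫ α.hom = cokerπ (K.toCycles i j) :=
    (K.homologyIsCokernel i j hij).comp_coconePointUniqueUpToIso_hom _ WalkingParallelPair.one
  have h : α.hom (K.homologyπ j z) = Submodule.mkQ _ z := ConcreteCategory.congr_hom hα z
  rw [hz, map_zero] at h
  exact (Submodule.Quotient.mk_eq_zero _).1 h.symm

theorem iCycles_injective (j : ι) : Function.Injective (K.iCycles j) := by
  let α := (K.cyclesIsKernel j (c.next j) rfl).conePointUniqueUpToIso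
    (isLimitKer (K.d j (c.next j)))
  have hα : α.hom ≫ kerι (K.d j (c.next j)) = K.iCycles j :=
    (K.cyclesIsKernel j _ rfl).conePointUniqueUpToIso_hom_comp
      (isLimitKer (K.d j (c.next j))) WalkingParallelPair.zero
  intro x y hxy
  have hx := ConcreteCategory.congr_hom hα x
  have hy := ConcreteCategory.congr_hom hα y
  have h : α.hom x = α.hom y := Subtype.ext (hx.trans (hxy.trans hy.symm))
  simpa using congrArg α.inv h

theorem homologyπ_eq_zero_iff {i j : ι} (hij : c.prev j = i) (z : K.cycles j) :
    K.homologyπ j z = 0 ↔ ∃ y : K.X i, K.d i j y = K.iCycles j z := by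
  constructor
  · intro h
    obtain ⟨y, rfl⟩ := exists_toCycles_eq_of_homologyπ_eq_zero K hij h
    exact ⟨y, (ConcreteCategory.congr_hom (K.toCycles_i i j) y).symm⟩
  · rintro ⟨y, hy⟩
    have h : K.toCycles i j y = z := iCycles_injective K j
      ((ConcreteCategory.congr_hom (K.toCycles_i i j) y).trans hy)
    rw [← h]
    exact ConcreteCategory.congr_hom (K.toCycles_comp_homologyπ i j) y

end TopModuleCat

/-! ### Continuous H² in terms of inhomogeneous cocycles -/

namespace ContinuousCohomology

open TopRep ContRepresentation

universe u w

variable {k : Type w} [Ring k] [TopologicalSpace k] {G : Type u} [Group G]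
  [TopologicalSpace G] [IsTopologicalGroup G] {X : TopRep.{u} k G}

theorem d_one_apply (σ : (homogeneousCochains X).X 1) (a b c : G) :
    (((homogeneousCochains X).d 1 2 σ).1 a b c : X) =
      (σ.1 b c : X) - (σ.1 a c : X) + (σ.1 a b : X) := by
  have h := homogeneousCochains.d_apply X 1 σ
  have h2 := congrArg (fun F : C(G, C(G, C(G, X))) => F a b c) h
  refine h2.trans ?_
  change (σ.1 b c : X) - ((σ.1 a c : X) - (σ.1 a b : X)) = _
  abel

theorem d_two_apply (σ : (homogeneousCochains X).X 2) (a b c d : G) :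
    (((homogeneousCochains X).d 2 3 σ).1 a b c d : X) =
      (σ.1 b c d : X) - (σ.1 a c d : X) + (σ.1 a b d : X) - (σ.1 a b c : X) := by
  have h := homogeneousCochains.d_apply X 2 σ
  have h2 := congrArg (fun F : C(G, C(G, C(G, C(G, X)))) => F a b c d) h
  refine h2.trans ?_
  change (σ.1 b c d : X) - ((σ.1 a c d : X) - ((σ.1 a b d : X) - (σ.1 a b c : X))) = _
  abel

theorem invariant_one (σ : (homogeneousCochains X).X 1) (g a b : G) :
    (σ.1 (g * a) (g * b) : X) = X.ρ g (σ.1 a b : X) := by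
  have h := congrArg (fun F : C(G, C(G, X)) => F (g * a) (g * b)) (σ.2 g)
  refine h.symm.trans ?_
  change X.ρ g (σ.1 (g⁻¹ * (g * a)) (g⁻¹ * (g * b)) : X) = _
  simp only [inv_mul_cancel_left]

theorem invariant_two (σ : (homogeneousCochains X).X 2) (g a b c : G) :
    (σ.1 (g * a) (g * b) (g * c) : X) = X.ρ g (σ.1 a b c : X) := by
  have h := congrArg (fun F : C(G, C(G, C(G, X))) => F (g * a) (g * b) (g * c)) (σ.2 g)
  refine h.symm.trans ?_
  change X.ρ g (σ.1 (g⁻¹ * (g * a)) (g⁻¹ * (g * b)) (g⁻¹ * (g * c)) : X) = _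
  simp only [inv_mul_cancel_left]

/-- The value `F(a, b, c)` of a homogeneous 2-cochain. -/
def eval₂ (F : (homogeneousCochains X).X 2) (a b c : G) : X :=
  (F.1 : C(G, C(G, C(G, X)))) a b c

/-- The inhomogeneous 2-cochain `F(1, x, xy)` attached to a homogeneous 2-cochain `F`. -/
def inhomogeneous (F : (homogeneousCochains X).X 2) (x y : G) : X :=
  eval₂ F 1 x (x * y)

/-- By invariance, a homogeneous cochain is determined by its inhomogeneous form. -/
theorem inhomogeneous_smul (F : (homogeneousCochains X).X 2) (a b d : G) :
    X.ρ a (inhomogeneous F (a⁻¹ * b) (b⁻¹ * d)) = eval₂ F a b d := by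
  have h : X.ρ a (eval₂ F 1 (a⁻¹ * b) (a⁻¹ * d)) =
      eval₂ F (a * 1) (a * (a⁻¹ * b)) (a * (a⁻¹ * d)) :=
    (invariant_two F a 1 (a⁻¹ * b) (a⁻¹ * d)).symm
  have h7 : a⁻¹ * b * (b⁻¹ * d) = a⁻¹ * d := by group
  rw [mul_one, mul_inv_cancel_left, mul_inv_cancel_left] at h
  rw [inhomogeneous, h7, h]

theorem inhomogeneous_cocycle (F : (homogeneousCochains X).X 2)
    (hF : (homogeneousCochains X).d 2 3 F = 0) (x y w : G) :
    X.ρ x (inhomogeneous F y w) - inhomogeneous F (x * y) w + inhomogeneous F x (y * w) -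
      inhomogeneous F x y = 0 := by
  have h := d_two_apply F 1 x (x * y) (x * y * w)
  rw [hF] at h
  have h1 := inhomogeneous_smul F x (x * y) (x * y * w)
  rw [inv_mul_cancel_left, inv_mul_cancel_left] at h1
  rw [h1, inhomogeneous, inhomogeneous, inhomogeneous, ← mul_assoc]
  exact h.symm

theorem exists_cochainsMap_eq_d {H : Type u} [Group H] [TopologicalSpace H]
    [IsTopologicalGroup H] (φ : H →ₜ* G) (z : cocycles X 2)
    (hz : map φ (𝟙 (res (φ : H →* G) X)) 2 (π X 2 z) = 0) :
    ∃ σ, (homogeneousCochains (res (φ : H →* G) X)).d 1 2 σ =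
      (cochainsMap φ (𝟙 (res (φ : H →* G) X))).f 2 ((homogeneousCochains X).iCycles 2 z) := by
  have e := HomologicalComplex.homologyπ_naturality (cochainsMap φ (𝟙 (res (φ : H →* G) X))) 2
  have e1 := ConcreteCategory.congr_hom e z
  rw [ConcreteCategory.comp_apply, ConcreteCategory.comp_apply] at e1
  have h1 := e1.symm.trans hz
  obtain ⟨σ, hσ⟩ := (TopModuleCat.homologyπ_eq_zero_iff _ (i := 1) (by simp) _).1 h1
  refine ⟨σ, hσ.trans ?_⟩
  have e2 := HomologicalComplex.cyclesMap_i (cochainsMap φ (𝟙 (res (φ : H →* G) X))) 2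
  have e3 := ConcreteCategory.congr_hom e2 z
  rw [ConcreteCategory.comp_apply, ConcreteCategory.comp_apply] at e3
  exact e3

/-- The witness is h(x) = σ(1, x); the identity is dσ evaluated at (1, x, xy). -/
theorem exists_coboundary_of_cochainsMap_eq_d {H : Type u} [Group H] [TopologicalSpace H]
    [IsTopologicalGroup H] (φ : H →ₜ* G) (F : (homogeneousCochains X).X 2)
    (σ : (homogeneousCochains (res (φ : H →* G) X)).X 1)
    (hσ : (homogeneousCochains (res (φ : H →* G) X)).d 1 2 σ =
      (cochainsMap φ (𝟙 (res (φ : H →* G) X))).f 2 F) :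
    ∃ h : H → X, ∀ x y, inhomogeneous F (φ x) (φ y) = X.ρ (φ x) (h y) - h (x * y) + h x := by
  refine ⟨fun x => (σ.1 : C(H, C(H, X))) 1 x, fun x y => ?_⟩
  have h3 := d_one_apply σ 1 x (x * y)
  rw [hσ] at h3
  have h4 : (σ.1 : C(H, C(H, X))) (x * 1) (x * y) = X.ρ (φ x) ((σ.1 : C(H, C(H, X))) 1 y) :=
    invariant_one σ x 1 y
  rw [mul_one] at h4
  rw [← h4]
  refine Eq.trans ?_ h3
  change _ = eval₂ F (φ 1) (φ x) (φ (x * y))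
  rw [map_one, map_mul, inhomogeneous]

theorem homologyπ_eq_zero_of_coboundary [DiscreteTopology G]
    (z : cocycles X 2) (h : G → X)
    (hh : ∀ x y, inhomogeneous ((homogeneousCochains X).iCycles 2 z) x y =
      X.ρ x (h y) - h (x * y) + h x) : π X 2 z = 0 := by
  refine (TopModuleCat.homologyπ_eq_zero_iff _ (i := 1) (by simp) _).2 ?_
  -- The homogeneous cochain attached to h; discreteness of G makes it continuous.
  let τ : C(G, C(G, X)) :=
    ⟨fun a => ⟨fun b => X.ρ a (h (a⁻¹ * b)), continuous_of_discreteTopology⟩,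
      continuous_of_discreteTopology⟩
  have hτ : τ ∈ (resolutionX X 2).ρ.invariants := by
    intro g
    refine ContinuousMap.ext fun a => ContinuousMap.ext fun b => ?_
    change X.ρ g (X.ρ (g⁻¹ * a) (h ((g⁻¹ * a)⁻¹ * (g⁻¹ * b)))) = X.ρ a (h (a⁻¹ * b))
    have h1 : (g⁻¹ * a)⁻¹ * (g⁻¹ * b) = a⁻¹ * b := by group
    have h2 : X.ρ a = X.ρ g * X.ρ (g⁻¹ * a) := by rw [← map_mul, mul_inv_cancel_left]
    rw [h1, h2]
    rfl
  refine ⟨⟨τ, hτ⟩, Subtype.ext (ContinuousMap.ext fun a => ContinuousMap.ext fun b =>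
    ContinuousMap.ext fun d => ?_)⟩
  refine (d_one_apply ⟨τ, hτ⟩ a b d).trans ?_
  refine Eq.trans ?_ (inhomogeneous_smul ((homogeneousCochains X).iCycles 2 z) a b d)
  change X.ρ b (h (b⁻¹ * d)) - X.ρ a (h (a⁻¹ * d)) + X.ρ a (h (a⁻¹ * b)) = _
  have h7 : a⁻¹ * b * (b⁻¹ * d) = a⁻¹ * d := by group
  have h2 : X.ρ b = X.ρ a * X.ρ (a⁻¹ * b) := by rw [← map_mul, mul_inv_cancel_left]
  rw [hh, h7, map_add, map_sub, h2]
  rfl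

/-- A class in `H²(G, X)` is represented by an inhomogeneous 2-cocycle, which is a coboundary after
pulling back along any homomorphism that kills the class. -/
theorem exists_inhomogeneous_cocycle [DiscreteTopology G] (c : continuousCohomology 2 X) :
    ∃ f : G → G → X,
      (∀ x y w, X.ρ x (f y w) - f (x * y) w + f x (y * w) - f x y = 0) ∧
      (∀ {H : Type u} [Group H] [TopologicalSpace H] [IsTopologicalGroup H] (φ : H →ₜ* G),
        map φ (𝟙 (res (φ : H →* G) X)) 2 c = 0 →
          ∃ h : H → X, ∀ x y, f (φ x) (φ y) = X.ρ (φ x) (h y) - h (x * y) + h x) ∧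
      ((∃ h : G → X, ∀ x y, f x y = X.ρ x (h y) - h (x * y) + h x) → c = 0) := by
  obtain ⟨z, hz⟩ := TopModuleCat.homologyπ_surjective (homogeneousCochains X) 2 c
  refine ⟨inhomogeneous ((homogeneousCochains X).iCycles 2 z), inhomogeneous_cocycle _ ?_, ?_, ?_⟩
  · have e := ConcreteCategory.congr_hom ((homogeneousCochains X).iCycles_d 2 3) z
    rw [ConcreteCategory.comp_apply] at e
    exact e
  · intro H _ _ _ φ hc
    rw [← hz] at hc
    obtain ⟨σ, hσ⟩ := exists_cochainsMap_eq_d φ z hc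
    exact exists_coboundary_of_cochainsMap_eq_d φ _ σ hσ
  · rintro ⟨h, hh⟩
    rw [← hz]
    exact homologyπ_eq_zero_of_coboundary z h hh

theorem pullbackH2_comp {G H K : Type u} [Group G] [TopologicalSpace G] [IsTopologicalGroup G]
    [Group H] [TopologicalSpace H] [IsTopologicalGroup H]
    [Group K] [TopologicalSpace K] [IsTopologicalGroup K]
    (φ : H →ₜ* G) (ψ : K →ₜ* H) (X : TopRep.{u} ℤ G) (c : continuousCohomology 2 X) :
    pullbackH2 (φ.comp ψ) X c = pullbackH2 ψ (res (φ : H →* G) X) (pullbackH2 φ X c) :=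
  ConcreteCategory.congr_hom
    (map_comp φ ψ (X := X) (𝟙 (res (φ : H →* G) X))
      (𝟙 (res (ψ : K →* H) (res (φ : H →* G) X))) 2) c

theorem pullbackH2_apply {G H : Type u} [Group G] [TopologicalSpace G] [IsTopologicalGroup G]
    [Group H] [TopologicalSpace H] [IsTopologicalGroup H]
    (φ : H →ₜ* G) (X : TopRep.{u} ℤ G) (c : continuousCohomology 2 X) :
    pullbackH2 φ X c = map φ (𝟙 (res (φ : H →* G) X)) 2 c :=
  rfl

end ContinuousCohomology

/-! ### Splitting surjections onto elementary abelian groups -/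

theorem AddMonoidHom.exists_section_of_zmodModule {p : ℕ} [Fact p.Prime] {U A : Type*}
    [AddCommGroup U] [AddCommGroup A] [Module (ZMod p) U] [Module (ZMod p) A] (π : U →+ A)
    (hπ : Function.Surjective π) : ∃ r : A →+ U, ∀ a, π (r a) = a := by
  obtain ⟨g, hg⟩ := LinearMap.exists_rightInverse_of_surjective (π.toZModLinearMap p)
    (LinearMap.range_eq_top.2 hπ)
  exact ⟨g.toAddMonoidHom, fun a => LinearMap.congr_fun hg a⟩

theorem exists_section_of_elementary {p : ℕ} [Fact p.Prime] {U A : Type*} [Group U]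
    [CommGroup A] (hc : ∀ u v : U, u * v = v * u) (hU : ∀ u : U, u ^ p = 1)
    (hA : ∀ a : A, a ^ p = 1) (π : U →* A)
    (hπ : Function.Surjective π) : ∃ r : A →* U, ∀ a, π (r a) = a := by
  let : CommGroup U := { ‹Group U› with mul_comm := hc }
  let : Module (ZMod p) (Additive U) := AddCommGroup.zmodModule fun u => hU u.toMul
  let : Module (ZMod p) (Additive A) := AddCommGroup.zmodModule fun a => hA a.toMul
  obtain ⟨g, hg⟩ := AddMonoidHom.exists_section_of_zmodModule (p := p) (MonoidHom.toAdditive π) hπ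
  exact ⟨MonoidHom.toAdditive.symm g, hg⟩

/-- The lifts from `hlift` depend on the pair; `hB` makes them compatible by allowing the lift of
one member to be changed when the other lies over B. -/
theorem exists_section_of_commuting_lifts {p : ℕ} [Fact p.Prime] {E A : Type*} [Group E]
    [CommGroup A] (hA : ∀ a : A, a ^ p = 1) (π : E →* A) (B : Subgroup A)
    (hB : ∀ x y : E, π x ∈ B → π y = 1 → Commute x y)
    (σ : A) (hσ : ∀ a : A, ∃ n : ℤ, ∃ b ∈ B, σ ^ n * b = a)
    (hlift : ∀ a b : A, ∃ x y : E, π x = a ∧ π y = b ∧ Commute x y ∧ y ^ p = 1) :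
    ∃ r : A →* E, ∀ a, π (r a) = a := by
  have key (x y x' y' : E) (hx : π x = π x') (hy : π y = π y') (hyB : π y ∈ B)
      (h : Commute x y) : Commute x' y := by
    -- Two lifts of the same element differ by the kernel, which y centralizes.
    have h1 : Commute y (x' * x⁻¹) := hB _ _ hyB (by rw [map_mul, map_inv, hx, mul_inv_cancel])
    simpa using h1.symm.mul_left h
  have hcomm (x y : E) (hx : π x ∈ B) (hy : π y ∈ B) : Commute x y := by
    obtain ⟨x', y', hx', hy', h, -⟩ := hlift (π x) (π y)
    -- Replace x' by x, then y' by y; both lie over B.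
    exact (key y' x y x hy' rfl hx
      (key x' y' x y' hx' rfl (hy' ▸ hy) h).symm).symm
  obtain ⟨-, s, -, hs, -, hsp⟩ := hlift σ σ
  have hv (b : B) : ∃ v : E, π v = b ∧ Commute s v ∧ v ^ p = 1 := by
    obtain ⟨x, y, hx, hy, h, hyp⟩ := hlift σ b
    exact ⟨y, hy, key x y s y (hx.trans hs.symm) rfl (hy ▸ b.2) h, hyp⟩
  choose v hvb hvs hvp using hv
  have hSc : ∀ x ∈ insert s (Set.range v), ∀ y ∈ insert s (Set.range v), x * y = y * x := by
    rintro x (rfl | ⟨b, rfl⟩) y (rfl | ⟨b', rfl⟩)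
    · rfl
    · exact hvs b'
    · exact (hvs b).symm
    · exact hcomm _ _ (hvb b ▸ b.2) (hvb b' ▸ b'.2)
  have hc (u w : Subgroup.closure (insert s (Set.range v))) : u * w = w * u :=
    (Subgroup.isMulCommutative_closure hSc).is_comm.comm u w
  have hU (u : Subgroup.closure (insert s (Set.range v))) : u ^ p = 1 := by
    obtain ⟨u, hu⟩ := u
    induction hu using Subgroup.closure_induction with
    | mem x hx =>
      refine Subtype.ext ?_
      obtain rfl | ⟨b, rfl⟩ := hx
      · exact hsp
      · exact hvp b
    | one => exact one_pow p
    | mul x y hx hy ihx ihy =>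
      have h := (show Commute (⟨x, hx⟩ : Subgroup.closure (insert s (Set.range v))) ⟨y, hy⟩ from
        hc _ _).mul_pow p
      rw [ihx, ihy, one_mul] at h
      exact h
    | inv x hx ih =>
      have h := inv_pow (⟨x, hx⟩ : Subgroup.closure (insert s (Set.range v))) p
      rw [ih, inv_one] at h
      exact h
  obtain ⟨r, hr⟩ := exists_section_of_elementary hc hU hA
    (π.comp (Subgroup.closure (insert s (Set.range v))).subtype) (by
      intro a
      obtain ⟨n, b, hb, rfl⟩ := hσ a
      refine ⟨⟨s, Subgroup.subset_closure (Set.mem_insert _ _)⟩ ^ n *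
        ⟨v ⟨b, hb⟩, Subgroup.subset_closure (Set.mem_insert_of_mem _ ⟨_, rfl⟩)⟩, ?_⟩
      rw [map_mul, map_zpow]
      exact congrArg₂ (fun x y => x ^ n * y) hs (hvb ⟨b, hb⟩))
  exact ⟨(Subgroup.closure (insert s (Set.range v))).subtype.comp r, hr⟩

/-! ### The group extension attached to a 2-cocycle -/

/-- The condition for `f` to be an inhomogeneous 2-cocycle. -/
def IsTwoCocycle {G M : Type*} [Group G] [AddCommGroup M] [DistribMulAction G M]
    (f : G → G → M) : Prop :=
  ∀ x y z, x • f y z - f (x * y) z + f x (y * z) - f x y = 0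

/-- The extension of `G` by `M` defined by a 2-cocycle `f`. -/
@[ext]
structure CocycleExtension {G M : Type*} [Group G] [AddCommGroup M] [DistribMulAction G M]
    {f : G → G → M} (hf : IsTwoCocycle f) where
  fiber : M
  base : G

namespace CocycleExtension

variable {G M : Type*} [Group G] [AddCommGroup M] [DistribMulAction G M]
  {f : G → G → M} (hf : IsTwoCocycle f)

theorem cocycle_one_left (hf : IsTwoCocycle f) (x : G) : f 1 x = f 1 1 := by
  have h := hf 1 1 x
  simp only [one_smul, one_mul, sub_self, zero_add] at h
  exact sub_eq_zero.1 h

theorem cocycle_one_right (hf : IsTwoCocycle f) (x : G) : f x 1 = x • f 1 1 := by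
  have h := hf x 1 1
  simp only [mul_one, sub_add_cancel] at h
  exact (sub_eq_zero.1 h).symm

instance : Mul (CocycleExtension hf) :=
  ⟨fun u v => ⟨u.fiber + u.base • v.fiber + f u.base v.base, u.base * v.base⟩⟩

/-- The cocycle is not normalized, hence the correction -f(1, 1). -/
instance : One (CocycleExtension hf) := ⟨⟨-f 1 1, 1⟩⟩

instance : Inv (CocycleExtension hf) :=
  ⟨fun u => ⟨-(u.base⁻¹ • u.fiber) - f u.base⁻¹ u.base - f 1 1, u.base⁻¹⟩⟩

@[simp] theorem fiber_mul (u v : CocycleExtension hf) :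
    (u * v).fiber = u.fiber + u.base • v.fiber + f u.base v.base := rfl

@[simp] theorem base_mul (u v : CocycleExtension hf) : (u * v).base = u.base * v.base := rfl

@[simp] theorem fiber_one : (1 : CocycleExtension hf).fiber = -f 1 1 := rfl

@[simp] theorem base_one : (1 : CocycleExtension hf).base = 1 := rfl

@[simp] theorem fiber_inv (u : CocycleExtension hf) :
    u⁻¹.fiber = -(u.base⁻¹ • u.fiber) - f u.base⁻¹ u.base - f 1 1 := rfl

@[simp] theorem base_inv (u : CocycleExtension hf) : u⁻¹.base = u.base⁻¹ := rfl

instance : Group (CocycleExtension hf) :=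
  Group.ofLeftAxioms
    (fun u v w => by
      ext
      · have h := hf u.base v.base w.base
        simp only [fiber_mul, base_mul, smul_add, smul_smul]
        rw [← sub_eq_zero, ← neg_eq_zero, ← h]
        abel
      · simp [mul_assoc])
    (fun u => by
      ext
      · simp [cocycle_one_left hf u.base]
      · simp)
    (fun u => by
      ext
      · simp only [fiber_mul, fiber_inv, base_inv, fiber_one]
        abel
      · simp)

/-- The projection onto `G`. -/
def proj : CocycleExtension hf →* G where
  toFun := base
  map_one' := rfl
  map_mul' _ _ := rfl

theorem commute_of_base_eq_one {u v : CocycleExtension hf} (hu : ∀ m : M, u.base • m = m)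
    (hv : v.base = 1) : Commute u v := by
  ext
  · simp only [fiber_mul, hv, one_smul, hu]
    rw [cocycle_one_left hf, cocycle_one_right hf, hu]
    abel
  · simp [hv]

/-- A cochain `h` whose coboundary is the pullback of `f` along `φ` defines a lift of `φ`. -/
def liftHom {H : Type*} [Group H] (φ : H →* G) (h : H → M)
    (hh : ∀ x y, f (φ x) (φ y) = φ x • h y - h (x * y) + h x) : H →* CocycleExtension hf :=
  MonoidHom.mk' (fun x => ⟨-h x, φ x⟩) (fun x y => by
    ext
    · simp only [fiber_mul, hh, smul_neg]
      abel
    · simp)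

theorem exists_coboundary_of_section (r : G →* CocycleExtension hf)
    (hr : ∀ g, proj hf (r g) = g) :
    ∃ h : G → M, ∀ x y, f x y = x • h y - h (x * y) + h x := by
  have hb (g : G) : (r g).base = g := hr g
  refine ⟨fun x => -(r x).fiber, fun x y => ?_⟩
  simp only [map_mul, fiber_mul, hb, smul_neg]
  abel

end CocycleExtension

/-! ### The action factors through a cyclic quotient -/

/-- By semisimplicity (x) = (g) with g idempotent. Primitivity applied to e = g + (e - g) gives g =
0, so x = 0, or g = e, so x is invertible in the corner and y = 0. -/
theorem IsPrimitiveIdempotent.noZeroDivisors_corner {R : Type*} [CommRing R] [IsSemisimpleRing R]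
    {e : R} (he : IsPrimitiveIdempotent e) : NoZeroDivisors he.idem.Corner := by
  refine ⟨fun {x y} hxy => ?_⟩
  have hmem (z : he.idem.Corner) : e * z.1 = z.1 := by
    obtain ⟨w, hw⟩ := z.2
    rw [← hw]
    change e * (e * w * e) = e * w * e
    linear_combination (w * e) * he.idem.eq
  have hxy' : x.1 * y.1 = 0 := congrArg Subtype.val hxy
  obtain ⟨g, hg, hspan⟩ := IsSemisimpleRing.ideal_eq_span_idempotent (Ideal.span {x.1})
  obtain ⟨t, ht⟩ := Ideal.mem_span_singleton'.1
    (hspan ▸ Ideal.mem_span_singleton_self g : g ∈ Ideal.span {x.1})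
  obtain ⟨w, hw⟩ := Ideal.mem_span_singleton'.1
    (hspan ▸ Ideal.mem_span_singleton_self x.1 : x.1 ∈ Ideal.span {g})
  have heg : e * g = g := by rw [← ht, mul_left_comm, hmem]
  have hidem : IsIdempotentElem (e - g) := by
    change (e - g) * (e - g) = e - g
    linear_combination he.idem.eq + hg.eq - 2 * heg
  have hdisj : g * (e - g) = 0 := by linear_combination heg - hg.eq
  obtain h | h := he.primitive g (e - g) hg hidem hdisj (by ring)
  · exact Or.inl (Subtype.ext (by rw [← hw, h, mul_zero]; rfl))
  · refine Or.inr (Subtype.ext ?_)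
    change y.1 = 0
    have hge : e = t * x.1 := (sub_eq_zero.1 h).trans ht.symm
    linear_combination y.1 * hge - hmem y + t * hxy'

theorem IsPrimitiveIdempotent.isDomain_corner {R : Type*} [CommRing R] [IsSemisimpleRing R]
    {e : R} (he : IsPrimitiveIdempotent e) : IsDomain he.idem.Corner := by
  have := he.noZeroDivisors_corner
  have : Nontrivial he.idem.Corner := ⟨1, 0, fun h => he.ne_zero (congrArg Subtype.val h)⟩
  exact NoZeroDivisors.to_isDomain _

/-- A finite group embedded in the units of a domain is cyclic; σ lifts a generator of the image. -/
theorem exists_zpow_mul_mem_ker {A R : Type*} [CommGroup A] [Finite A] [CommRing R] [IsDomain R]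
    (θ : A →* R) : ∃ σ : A, ∀ a : A, ∃ n : ℤ, ∃ b, θ b = 1 ∧ σ ^ n * b = a := by
  let ψ : A →* Rˣ := θ.toHomUnits
  have : IsCyclic (A ⧸ ψ.ker) :=
    isCyclic_of_injective_ringHom ((Units.coeHom R).comp (QuotientGroup.kerLift ψ))
      (Units.val_injective.comp (QuotientGroup.kerLift_injective ψ))
  obtain ⟨q, hq⟩ := IsCyclic.exists_generator (α := A ⧸ ψ.ker)
  obtain ⟨σ, rfl⟩ := QuotientGroup.mk_surjective q
  refine ⟨σ, fun a => ?_⟩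
  obtain ⟨n, hn⟩ := hq a
  exact ⟨n, (σ ^ n)⁻¹ * a, congrArg Units.val (QuotientGroup.eq.1 hn), mul_inv_cancel_left _ _⟩

theorem exists_zpow_mul_smul_eq {p : ℕ} [Fact p.Prime] {A : Type*} [CommGroup A] [Finite A]
    {e : MonoidAlgebra ℚ_[p] A} (he : IsPrimitiveIdempotent e) (I : Ideal (EZp he.idem)) :
    ∃ σ : A, ∀ a : A, ∃ n : ℤ, ∃ b : A,
      (∀ m : EZpQuot he.idem I, b • m = m) ∧ σ ^ n * b = a := by
  -- The input to Maschke's theorem, which makes ℚ_p[A] semisimple.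
  have : NeZero (Nat.card A : ℚ_[p]) := ⟨Nat.cast_ne_zero.2 Nat.card_pos.ne'⟩
  have := he.isDomain_corner
  obtain ⟨σ, hσ⟩ := exists_zpow_mul_mem_ker
    ((mulIdem he.idem).toMonoidHom.comp (MonoidAlgebra.of ℤ_[p] A))
  refine ⟨σ, fun a => ?_⟩
  obtain ⟨n, b, hb, rfl⟩ := hσ a
  refine ⟨n, b, fun m => ?_, rfl⟩
  change EZp.proj he.idem (MonoidAlgebra.of ℤ_[p] A b) • m = m
  have h : EZp.proj he.idem (MonoidAlgebra.of ℤ_[p] A b) = 1 := Subtype.ext hb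
  rw [h, one_smul]

/-! ### From local vanishing to a splitting -/

/-- The pair `(⟨a, b⟩, ⟨b⟩)`. -/
def CPair.ofPair {A : Type*} [CommGroup A] (a b : A) : CPair A where
  D := Subgroup.closure {a, b}
  I := Subgroup.zpowers ⟨b, Subgroup.subset_closure (by simp)⟩
  two_generated := ⟨a, b, rfl⟩
  cyclic := inferInstance
  cyclic_quotient := by
    refine ⟨QuotientGroup.mk ⟨a, Subgroup.subset_closure (by simp)⟩, fun q => ?_⟩
    obtain ⟨⟨d, hd⟩, rfl⟩ := QuotientGroup.mk_surjective q
    obtain ⟨m, n, rfl⟩ := Subgroup.mem_closure_pair.1 hd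
    exact ⟨m, QuotientGroup.eq.2 ⟨n, Subtype.ext (by simp)⟩⟩

universe u

theorem exists_commuting_lifts {A M : Type u} [CommGroup A] [Finite A] [TopologicalSpace A]
    [DiscreteTopology A] [AddCommGroup M] [DistribMulAction A M]
    {f : A → A → M} (hf : IsTwoCocycle f) {p : ℕ} (hA : ∀ a : A, a ^ p = 1)
    (hres : ∀ c : CPair A, ∃ h : DHat c.I → M, ∀ x y,
      f (x.1.2 : A) (y.1.2 : A) = (x.1.2 : A) • h y - h (x * y) + h x) (a b : A) :
    ∃ x y : CocycleExtension hf, CocycleExtension.proj hf x = a ∧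
      CocycleExtension.proj hf y = b ∧ Commute x y ∧ y ^ p = 1 := by
  let c := CPair.ofPair a b
  obtain ⟨h, hh⟩ := hres c
  let a' : c.D := ⟨a, Subgroup.subset_closure (by simp)⟩
  let b' : c.D := ⟨b, Subgroup.subset_closure (by simp)⟩
  let r : DHat c.I →* CocycleExtension hf := CocycleExtension.liftHom hf
    ((c.D.subtype.comp (MonoidHom.snd ZHat c.D)).comp (DHat c.I).subtype) h hh
  obtain ⟨z, hz⟩ := ZHat.toCyclic_surjective (c.D ⧸ c.I) (a' : c.D ⧸ c.I)
  let x : DHat c.I := ⟨(z, a'), hz⟩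
  -- Since b generates I, its lift to D̂ can have trivial ℤ̂-component and so keep p-th power 1; the
  -- lift (z, a) need not be torsion.
  let y : DHat c.I := ⟨(1, b'), (map_one (ZHat.toCyclic (c.D ⧸ c.I))).trans
    ((QuotientGroup.eq_one_iff b').2 (Subgroup.mem_zpowers _)).symm⟩
  have hxy : Commute x y := Subtype.ext (Prod.ext
    ((mul_one z).trans (one_mul z).symm) (mul_comm a' b'))
  have hy : y ^ p = 1 := Subtype.ext (Prod.ext (one_pow p) (Subtype.ext (hA b)))
  exact ⟨r x, r y, rfl, rfl, hxy.map r, by rw [← map_pow, hy, map_one]⟩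

/-- The vanishing of `N_typical` when the group acts through a cyclic quotient. -/
theorem NTypical_eq_bot {p : ℕ} [Fact p.Prime] {A M : Type u} [CommGroup A] [Finite A]
    [TopologicalSpace A] [DiscreteTopology A] [AddCommGroup M] [TopologicalSpace M]
    [DiscreteTopology M] [DistribMulAction A M] (hA : ∀ a : A, a ^ p = 1) (σ : A)
    (hσ : ∀ a : A, ∃ n : ℤ, ∃ b : A, (∀ m : M, b • m = m) ∧ σ ^ n * b = a) :
    NTypical A M = ⊥ := by
  rw [eq_bot_iff]
  intro c hc
  rw [AddSubgroup.mem_bot]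
  obtain ⟨f, hf, hpull, hzero⟩ : ∃ f : A → A → M, IsTwoCocycle f ∧
      (∀ {H : Type u} [Group H] [TopologicalSpace H] [IsTopologicalGroup H] (φ : H →ₜ* A),
        ContinuousCohomology.map φ (𝟙 (TopRep.res (φ : H →* A) (discreteRep A M))) 2 c = 0 →
          ∃ h : H → M, ∀ x y, f (φ x) (φ y) = φ x • h y - h (x * y) + h x) ∧
      ((∃ h : A → M, ∀ x y, f x y = x • h y - h (x * y) + h x) → c = 0) :=
    ContinuousCohomology.exists_inhomogeneous_cocycle c
  refine hzero ?_
  have hres (d : CPair A) : ∃ h : DHat d.I → M, ∀ x y,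
      f (x.1.2 : A) (y.1.2 : A) = (x.1.2 : A) • h y - h (x * y) + h x := by
    have h1 := congrFun hc d
    -- Zero modulo R(D, I, M) means that the restriction to D is killed by inflation to D̂.
    have h2 := (QuotientAddGroup.eq_zero_iff _).1 h1
    refine hpull ((inclusionHom d.D).comp (DHat.proj d.I)) ?_
    rw [← ContinuousCohomology.pullbackH2_apply, ContinuousCohomology.pullbackH2_comp]
    exact h2
  let B : Subgroup A := (MulAction.toPermHom A M).ker
  have hBmem (b : A) : b ∈ B ↔ ∀ m : M, b • m = m := Equiv.ext_iff
  obtain ⟨r, hr⟩ := exists_section_of_commuting_lifts hA (CocycleExtension.proj hf) B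
    (fun x y hx hy => CocycleExtension.commute_of_base_eq_one hf ((hBmem _).1 hx) hy) σ
    (fun a => by
      obtain ⟨n, b, hb, h⟩ := hσ a
      exact ⟨n, b, (hBmem b).2 hb, h⟩)
    (exists_commuting_lifts hf hA hres)
  exact CocycleExtension.exists_coboundary_of_section hf r hr

end

theorem mainTheorem12 {p : ℕ} [Fact p.Prime] (hp : p ≠ 2)
    {A : Type*} [CommGroup A] [Fintype A] [TopologicalSpace A] [DiscreteTopology A]
    (hA : ∀ γ : A, γ ^ p = 1)
    {e : MonoidAlgebra ℚ_[p] A} (he : IsPrimitiveIdempotent e) (hne : e ≠ trivialIdempotent p A)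
    (I : Ideal (EZp he.idem)) (hI : I ≠ ⊤) (hIe : idealIe he.idem ≤ I) :
    NTypical A (EZpQuot he.idem I) = ⊥ := by
  obtain ⟨σ, hσ⟩ := exists_zpow_mul_smul_eq he I
  exact NTypical_eq_bot hA σ hσ
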